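/- Let $\mathcal G$ be a real normed space, $\mathcal D\subset\mathcal G$ with the induced topology, and $\mathcal H$ a real Hilbert space. Let $$C(p)=\{x\in\mathcal H : \langle x, g_i(p)\rangle = f_i(p)\ (i\in I_1),\ \ \langle x, g_i(p)\rangle\le f_i(p)\ (i\in I_2)\},\qquad p\in\mathcal D,$$ where $I_1,I_2$ are finite disjoint index sets with $I_1\cup I_2\ne\emptyset$ and all $f_i:\mathcal D\to\mathbb R$, $g_i:\mathcal D\to\mathcal H$ are locally Lipschitz. For $x\in C(p)$ let $N(x;C(p))=\{h\in\mathcal H : \langle h,y-x\rangle\le 0\ \ \forall y\in C(p)\}$, and let $\operatorname{gph}N(\cdot;C(p))=\{(x,x'): x\in C(p),\ x'\in N(x;C(p))\}$. Let $\bar p\in\mathcal D$, $\bar x\in C(\bar p)$, $\bar v\in\mathcal H$ with $\bar v-\bar x\in N(\bar x;C(\bar p))$, and suppose that at least one constraint of the system defining $C(\bar p)$ holds with equality at $\bar x$. Let $\mathcal R$ be an equivalent representation of $p\mapsto C(p)$, that is, a system of the same kind, with finite disjoint index sets $\tilde I_1,\tilde I_2$, $\tilde I_1\cup\tilde I_2\neq\emptyset$,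 and locally Lipschitz data $\tilde f_i,\tilde g_i$ on $\mathcal D$, whose solution set $R(p)$ equals $C(p)$ for every $p\in\mathcal D$. Put $I^{\mathcal R}_p(x)=\{i\in\tilde I_1\cup\tilde I_2 : \langle x,\tilde g_i(p)\rangle=\tilde f_i(p)\}$. Assume: (a) (RCRCQ at $(\bar p,\bar x)$) there is a neighbourhood $U_0$ of $\bar p$ in $\mathcal D$ such that $\operatorname{rank}\{\tilde g_i(p): i\in J\}=\operatorname{rank}\{\tilde g_i(\bar p): i\in J\}$ for all $p\in U_0$ and all $J$ with $\tilde I_1\subset J\subset I^{\mathcal R}_{\bar p}(\bar x)$; (b) ($\mathcal R$ is stable at $(\bar p,\bar v,\bar x)$ with the set $\bar K$) $\bar K\subset I^{\mathcal R}_{\bar p}(\bar x)\cap\tilde I_2$, the vectors $\tilde g_i(\bar p)$, $i\in\tilde I_1\cup\bar K$, are linearly independent, $\bar v-\bar x=\sum_{i\in\tilde I_1\cup\bar K}\bar\lambda_i\tilde g_i(\bar p)$ with $\bar\lambda_i\in\mathbb R$ and $\bar\lambda_i>0$ for $i\in\bar K$, and for every admissible $L$, every neighbourhood of $\bar x$ meets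 $R_{\bar K,L}(p)$ for all $p\in\mathcal D$ sufficiently close to $\bar p$. Here a (possibly empty) set $L$ is called admissible if $L\subset(I^{\mathcal R}_{\bar p}(\bar x)\cap\tilde I_2)\setminus\bar K$ and the vectors $\tilde g_i(\bar p)$, $i\in\tilde I_1\cup\bar K\cup L$, are linearly independent, and $R_{\bar K,L}(p)$ is the set of $x\in\mathcal H$ with $\langle x,\tilde g_i(p)\rangle=\tilde f_i(p)$ for $i\in\tilde I_1\cup\bar K\cup L$ and $\langle x,\tilde g_i(p)\rangle\le\tilde f_i(p)$ for $i\in\tilde I_2\setminus(\bar K\cup L)$. Then there is a constant $\ell>0$ such that for every $\varepsilon>0$ there are neighbourhoods $U$ of $\bar p$ in $\mathcal D$ and $V$ of $0$ in $\mathcal H$ with the following two properties. (1) For all $p\in U$ and all $(x,x')\in\operatorname{gph}N(\cdot;C(p))$ with $x\in\bar x+V$, $x'\in\bar v-\bar x+V$, there are an admissible set $\hat L$ with $$\hat L\subset (I^{\mathcal R}_p(x)\cap\tilde I_2)\setminus\bar K\subset(I^{\mathcal R}_{\bar p}(\bar x)\cap\tilde I_2)\setminus\bar K$$ and real numbers $\lambda_i$,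 $i\in\tilde I_1\cup\bar K\cup\hat L$, such that $$x'=\sum_{i\in\tilde I_1\cup\bar K\cup\hat L}\lambda_i\tilde g_i(p),\qquad \bar\lambda_i-\varepsilon\le\lambda_i\le\bar\lambda_i+\varepsilon\ \ (i\in\tilde I_1\cup\bar K),\qquad 0<\lambda_i\le\varepsilon\ \ (i\in\hat L).$$ (2) For every admissible $L$, all $p_1,p_2\in U$ and every $x_1\in(\bar x+V)\cap R_{\bar K,L}(p_1)$ there is $x_2\in R_{\bar K,L}(p_2)$ with $\|x_1-x_2\|\le\ell\,\|p_1-p_2\|$. Moreover, with the same $\ell$, for every admissible $L$ the multifunction $p\mapsto R_{\bar K,L}(p)$ is Lipschitz-like around $(\bar p,\bar x)$ with modulus $\ell$: $\bar x\in R_{\bar K,L}(\bar p)$ and there are neighbourhoods $U'$ of $\bar p$ in $\mathcal D$ and $V'$ of $\bar x$ such that $R_{\bar K,L}(p_1)\cap V'\subset R_{\bar K,L}(p_2)+\ell\|p_1-p_2\|B(0,1)$ for all $p_1,p_2\in U'$, where $B(0,1)$ is the open unit ball of $\mathcal H$. -/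

import Mathlib

open Set Filter Topology
open scoped Pointwise

/-- The normal cone, in the sense of convex analysis, to a set `C` at a point `x` (of `C`). -/
def normalConeAt {H : Type*} [NormedAddCommGroup H] [InnerProductSpace ℝ H]
    (C : Set H) (x : H) : Set H :=
  {h | ∀ y ∈ C, inner ℝ h (y - x) ≤ 0}

/-- The graph of the normal cone map `x ↦ N(x; C)`, whose domain is `C`. -/
def normalConeGraph {H : Type*} [NormedAddCommGroup H] [InnerProductSpace ℝ H]
    (C : Set H) : Set (H × H) :=
  {z | z.1 ∈ C ∧ z.2 ∈ normalConeAt C z.1}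

/-- `y` belongs to the lower Kuratowski limit of `F(p)` as `p → p₀` in `D`: every neighbourhood
of `y` meets `F(p)` for all `p` in some neighbourhood of `p₀` in `D`. -/
def MemKuratowskiLiminf {G H : Type*} [NormedAddCommGroup G] [NormedAddCommGroup H]
    {D : Set G} (F : D → Set H) (p₀ : D) (y : H) : Prop :=
  ∀ V ∈ 𝓝 y, ∃ U ∈ 𝓝 p₀, ∀ p ∈ U, (V ∩ F p).Nonempty

/-- The multifunction `F` is Lipschitz-like (has the Aubin property) around the point `(p₀, y₀)` of
its graph, with modulus `ℓ`. -/
def LipschitzLikeAround {G H : Type*} [NormedAddCommGroup G] [NormedAddCommGroup H]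
    [NormedSpace ℝ H] {D : Set G} (F : D → Set H) (p₀ : D) (y₀ : H) (ℓ : ℝ) : Prop :=
  0 ≤ ℓ ∧ y₀ ∈ F p₀ ∧ ∃ U ∈ 𝓝 p₀, ∃ V ∈ 𝓝 y₀, ∀ p₁ ∈ U, ∀ p₂ ∈ U,
    F p₁ ∩ V ⊆ F p₂ + (ℓ * ‖(p₁ : G) - (p₂ : G)‖) • Metric.ball (0 : H) 1

/-- A finite system of parametric linear constraints with parameter `p ∈ D ⊆ G` on `x ∈ H`:
equalities `⟪x, g i p⟫ = f i p` for `i ∈ I₁`, inequalities `⟪x, g i p⟫ ≤ f i p` for the other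
indices, with locally Lipschitz data on `D` (for the topology and metric induced by `G`). -/
structure ConstraintSystem {G : Type*} [NormedAddCommGroup G] (D : Set G)
    (H : Type*) [NormedAddCommGroup H] [InnerProductSpace ℝ H] (ι : Type*) where
  /-- the indices of the equality constraints -/
  I₁ : Finset ι
  /-- the normal vectors -/
  g : ι → D → H
  /-- the right-hand sides -/
  f : ι → D → ℝ
  g_lipschitz : ∀ i, LocallyLipschitz (g i)
  f_lipschitz : ∀ i, LocallyLipschitz (f i)

namespace ConstraintSystem

variable {G : Type*} [NormedAddCommGroup G] {D : Set G}
  {H : Type*} [NormedAddCommGroup H] [InnerProductSpace ℝ H] {ι κ : Type*}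

/-- The indices of the inequality constraints. -/
def I₂ (R : ConstraintSystem D H κ) : Set κ := {i | i ∉ R.I₁}

/-- The solution set `R(p)` of the system with parameter `p`. -/
def sol (R : ConstraintSystem D H κ) (p : D) : Set H :=
  {x | (∀ i ∈ R.I₁, inner ℝ x (R.g i p) = R.f i p) ∧
       (∀ i ∈ R.I₂, inner ℝ x (R.g i p) ≤ R.f i p)}

/-- The set of indices that are active for the parameter `p` at `x`. -/
def active (R : ConstraintSystem D H κ) (p : D) (x : H) : Set κ :=
  {i | inner ℝ x (R.g i p) = R.f i p}

/-- `R` is an equivalent representation of `C`: both systems have the same solution set for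
every parameter. -/
def IsEquivalentRepresentation (R : ConstraintSystem D H κ) (C : ConstraintSystem D H ι) : Prop :=
  ∀ p, R.sol p = C.sol p

/-- The relaxed constant rank constraint qualification for `p ↦ R(p)` at `(p₀, x₀)`. -/
def RCRCQ (R : ConstraintSystem D H κ) (p₀ : D) (x₀ : H) : Prop :=
  x₀ ∈ R.sol p₀ ∧ ∃ U ∈ 𝓝 p₀, ∀ J : Finset κ, R.I₁ ⊆ J → (J : Set κ) ⊆ R.active p₀ x₀ →
    ∀ p ∈ U, Set.finrank ℝ ((fun i => R.g i p) '' (J : Set κ)) =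
      Set.finrank ℝ ((fun i => R.g i p₀) '' (J : Set κ))

variable [DecidableEq κ]

/-- The system in which the constraints with index in `S` are turned into equalities; `R_{K,L}`
is the solution map of `R.tighten (K ∪ L)`. -/
def tighten (R : ConstraintSystem D H κ) (S : Finset κ) : ConstraintSystem D H κ where
  I₁ := R.I₁ ∪ S
  g := R.g
  f := R.f
  g_lipschitz := R.g_lipschitz
  f_lipschitz := R.f_lipschitz

/-- `v₀ - x₀ = ∑ i ∈ I₁ ∪ K, μ i • g i p₀` where `μ i > 0` for `i ∈ K`, `K` consists of active
inequality indices and the vectors `g i p₀`, `i ∈ I₁ ∪ K`, are linearly independent. -/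
structure IsMultiplierRepresentation (R : ConstraintSystem D H κ) (p₀ : D) (v₀ x₀ : H)
    (K : Finset κ) (μ : κ → ℝ) : Prop where
  subset : (K : Set κ) ⊆ R.active p₀ x₀ ∩ R.I₂
  eq_sum : v₀ - x₀ = ∑ i ∈ R.I₁ ∪ K, μ i • R.g i p₀
  pos : ∀ i ∈ K, 0 < μ i
  linearIndep : LinearIndepOn ℝ (fun i => R.g i p₀) ((R.I₁ ∪ K : Finset κ) : Set κ)

/-- The index sets `L` (possibly empty) of active inequality indices outside `K` for which the
vectors `g i p₀`, `i ∈ I₁ ∪ K ∪ L`, are linearly independent. -/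
def IsAdmissible (R : ConstraintSystem D H κ) (p₀ : D) (x₀ : H) (K L : Finset κ) : Prop :=
  (L : Set κ) ⊆ (R.active p₀ x₀ ∩ R.I₂) \ (K : Set κ) ∧
    LinearIndepOn ℝ (fun i => R.g i p₀) ((R.I₁ ∪ K ∪ L : Finset κ) : Set κ)

/-- The equivalent representation `R` of `C` is stable at `(p₀, v₀, x₀)` with the index set `K`
and the multipliers `μ`. -/
structure IsStableRepresentation (R : ConstraintSystem D H κ) (C : ConstraintSystem D H ι)
    (p₀ : D) (v₀ x₀ : H) (K : Finset κ) (μ : κ → ℝ) : Prop where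
  equivalent : R.IsEquivalentRepresentation C
  multipliers : R.IsMultiplierRepresentation p₀ v₀ x₀ K μ
  liminf : ∀ L : Finset κ, R.IsAdmissible p₀ x₀ K L →
    MemKuratowskiLiminf (R.tighten (K ∪ L)).sol p₀ x₀

end ConstraintSystem

/-! ### Conic combinations with some free coefficients: Carathéodory, closedness, Farkas. -/

section ConicCombinations

variable {κ H : Type*} [DecidableEq κ]

/-! A normal vector to a polyhedron is a combination of active gradients (Farkas), and conic
Carathéodory makes the gradients used linearly independent (`exists_multipliers`). This happens at a
parameter `p` near `p₀`. The constant rank condition serves to carry the independence back to `p₀`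
(`RCRCQ.eventually_linearIndepOn`), since the indices involved are active at `(p₀, x₀)`. There are
finitely many index sets, and over a family independent at `p₀` the coefficients are bounded by a
constant times the norm of the combination, uniformly for `p` near `p₀`
(`exists_uniform_abs_coeff_le`).

Property (1): the gradients with index in `I₁ ∪ K` stay independent near `p₀`, so they may be kept
with free coefficients, and Carathéodory adds an independent set `L`. The difference between `x'`
and `∑ μ i • g i p` is small, and the uniform bound applied to it makes the multipliers close to `μ`
on `I₁ ∪ K` and close to `0` on `L`.

Property (2): project `x₁` onto the solution set at `p₂`. The lower limit hypothesis makes this set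
nonempty near `x₀`, so the projection `x₂` is near `x₀`. The residual `x₁ - x₂` is normal, hence
equal to `∑ c i • g i p₂` with `|c i| ≤ k * ‖x₁ - x₂‖`. Expanding `‖x₁ - x₂‖²` along this sum and
using feasibility of `x₁` at `p₁` bounds each term by a multiple of `‖p₁ - p₂‖ * ‖x₁ - x₂‖`
(`RCRCQ.exists_lipschitz_selection`). This applies to every tightened system, because tightening
preserves the rank condition. -/

theorem sum_union_erase_of_eq_zero [AddCommGroup H] [Module ℝ H] {g : κ → H} {B A : Finset κ}
    {m : κ} {c : κ → ℝ} (hc : c m = 0) :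
    ∑ i ∈ B ∪ A.erase m, c i • g i = ∑ i ∈ B ∪ A, c i • g i := by
  refine Finset.sum_subset (Finset.union_subset_union_right (Finset.erase_subset _ _)) ?_
  intro i hi hi'
  have : i = m := by
    by_contra hne
    simp only [Finset.mem_union, Finset.mem_erase] at hi hi'
    tauto
  simp [this, hc]

/-- Conic Carathéodory theorem relative to a linearly independent family with free coefficients. -/
theorem exists_pos_combination [AddCommGroup H] [Module ℝ H] {g : κ → H} {B : Finset κ}
    (hB : LinearIndepOn ℝ g (B : Set κ)) (A : Finset κ) (hBA : Disjoint B A) (c : κ → ℝ)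
    (hc : ∀ i ∈ A, 0 ≤ c i) :
    ∃ L ⊆ A, LinearIndepOn ℝ g ((B ∪ L : Finset κ) : Set κ) ∧
      ∃ d : κ → ℝ, (∀ i ∈ L, 0 < d i) ∧ ∑ i ∈ B ∪ L, d i • g i = ∑ i ∈ B ∪ A, c i • g i := by
  induction A using Finset.strongInduction generalizing c with
  | H A ih =>
    -- A vanishing coefficient allows its index to be dropped, which is the induction step.
    have step : ∀ c : κ → ℝ, (∀ i ∈ A, 0 ≤ c i) → (∃ m ∈ A, c m = 0) →
        ∃ L ⊆ A, LinearIndepOn ℝ g ((B ∪ L : Finset κ) : Set κ) ∧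
          ∃ d : κ → ℝ, (∀ i ∈ L, 0 < d i) ∧
            ∑ i ∈ B ∪ L, d i • g i = ∑ i ∈ B ∪ A, c i • g i := by
      rintro c hc ⟨m, hm, hcm⟩
      obtain ⟨L, hL, hLI, d, hd, hsum⟩ := ih (A.erase m) (Finset.erase_ssubset hm)
        (hBA.mono_right (Finset.erase_subset _ _)) c
        (fun i hi => hc i (Finset.mem_of_mem_erase hi))
      exact ⟨L, hL.trans (Finset.erase_subset _ _), hLI, d, hd,
        hsum.trans (sum_union_erase_of_eq_zero hcm)⟩
    by_cases hz : ∃ m ∈ A, c m = 0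
    · exact step c hc hz
    by_cases hLI : LinearIndepOn ℝ g ((B ∪ A : Finset κ) : Set κ)
    · refine ⟨A, subset_rfl, hLI, c, fun i hi => lt_of_le_of_ne (hc i hi) ?_, rfl⟩
      exact fun h => hz ⟨i, hi, h.symm⟩
    obtain ⟨r₀, hr₀, i₀, hi₀, hne₀⟩ := not_linearIndepOn_finset_iff.1 hLI
    -- The dependence relation must involve `A`, as `B` alone is independent.
    obtain ⟨j, hj, hrj⟩ : ∃ j ∈ A, r₀ j ≠ 0 := by
      by_contra! hcon
      have hsum : ∑ i ∈ B, r₀ i • g i = 0 := by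
        rw [Finset.sum_union hBA, Finset.sum_eq_zero (s := A) (fun i hi => by simp [hcon i hi]),
          add_zero] at hr₀
        exact hr₀
      rcases Finset.mem_union.1 hi₀ with h | h
      · exact hne₀ (linearIndepOn_finset_iff.1 hB r₀ hsum i₀ h)
      · exact hne₀ (hcon i₀ h)
    obtain ⟨r, hr, hrpos⟩ : ∃ r : κ → ℝ, ∑ i ∈ B ∪ A, r i • g i = 0 ∧ 0 < r j := by
      refine ⟨fun i => r₀ j * r₀ i, ?_, mul_self_pos.2 hrj⟩
      simp only [mul_smul]
      rw [← Finset.smul_sum, hr₀, smul_zero]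
    -- Ratio test: subtracting the least ratio `c m / r m` times the relation kills the coefficient
    -- of `m` and keeps those on `A` nonnegative.
    obtain ⟨m, hm, hmin⟩ := Finset.exists_min_image (A.filter fun i => 0 < r i)
      (fun i => c i / r i) ⟨j, Finset.mem_filter.2 ⟨hj, hrpos⟩⟩
    obtain ⟨hmA, hrm⟩ := Finset.mem_filter.1 hm
    have ht : 0 ≤ c m / r m := div_nonneg (hc m hmA) hrm.le
    obtain ⟨L, hL, hLI', d, hd, hsum⟩ := step (fun i => c i - c m / r m * r i)
      (fun i hi => by
        rcases lt_or_ge 0 (r i) with h | h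
        · have := hmin i (Finset.mem_filter.2 ⟨hi, h⟩)
          rw [le_div_iff₀ h] at this
          exact sub_nonneg.2 this
        · have := mul_nonpos_of_nonneg_of_nonpos ht h
          have := hc i hi
          linarith)
      ⟨m, hmA, by field_simp; ring⟩
    refine ⟨L, hL, hLI', d, hd, hsum.trans ?_⟩
    simp only [sub_smul, Finset.sum_sub_distrib, mul_smul]
    rw [← Finset.smul_sum, hr, smul_zero, sub_zero]

/-- The combinations of `g i`, `i ∈ B ∪ A`, with nonnegative coefficients for `i ∈ A`. -/
def conicCombinations [AddCommGroup H] [Module ℝ H] (g : κ → H) (B A : Finset κ) : Set H :=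
  {h | ∃ c : κ → ℝ, (∀ i ∈ A, 0 ≤ c i) ∧ ∑ i ∈ B ∪ A, c i • g i = h}

theorem convex_conicCombinations [AddCommGroup H] [Module ℝ H] (g : κ → H) (B A : Finset κ) :
    Convex ℝ (conicCombinations g B A) := by
  rintro _ ⟨c, hc, rfl⟩ _ ⟨d, hd, rfl⟩ a b ha hb -
  refine ⟨fun i => a * c i + b * d i, fun i hi => ?_, ?_⟩
  · have := hc i hi
    have := hd i hi
    positivity
  · simp only [add_smul, mul_smul, Finset.sum_add_distrib, Finset.smul_sum]

/-- By independence the map from coefficients to combinations is a closed embedding, and the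
admissible coefficients form a closed set. -/
theorem isClosed_conicCombinations_of_linearIndepOn [NormedAddCommGroup H] [NormedSpace ℝ H]
    {g : κ → H} {B A : Finset κ} (h : LinearIndepOn ℝ g ((B ∪ A : Finset κ) : Set κ)) :
    IsClosed (conicCombinations g B A) := by
  have hinj := h.linearIndependent.fintypeLinearCombination_injective
  have hemb := LinearMap.isClosedEmbedding_of_injective (LinearMap.ker_eq_bot.2 hinj)
  have hcl : IsClosed {c : ((B ∪ A : Finset κ) : Set κ) → ℝ |
      ∀ i : ((B ∪ A : Finset κ) : Set κ), (i : κ) ∈ A → 0 ≤ c i} := by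
    simp only [ofPred_forall]
    exact isClosed_iInter fun i => isClosed_iInter fun _ =>
      isClosed_le continuous_const (continuous_apply i)
  convert hemb.isClosedMap _ hcl using 1
  ext x
  constructor
  · rintro ⟨c, hc, rfl⟩
    refine ⟨fun i => c i, fun i hi => hc i hi, ?_⟩
    rw [Fintype.linearCombination_apply]
    exact Finset.sum_coe_sort (B ∪ A) (fun i => c i • g i)
  · rintro ⟨c, hc, rfl⟩
    refine ⟨fun i => if hi : i ∈ B ∪ A then c ⟨i, hi⟩ else 0, fun i hi => ?_, ?_⟩
    · have : i ∈ B ∪ A := Finset.mem_union_right _ hi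
      simpa only [this, dif_pos] using hc ⟨i, this⟩ hi
    · rw [Fintype.linearCombination_apply, ← Finset.sum_coe_sort (B ∪ A)]
      refine Finset.sum_congr rfl fun i _ => ?_
      simp only [dif_pos i.2]
      rfl

/-- By Carathéodory the cone is a finite union of cones over independent families, each of them
closed. -/
theorem isClosed_conicCombinations [NormedAddCommGroup H] [NormedSpace ℝ H]
    {g : κ → H} {B A : Finset κ} (hB : LinearIndepOn ℝ g (B : Set κ)) (hBA : Disjoint B A) :
    IsClosed (conicCombinations g B A) := by
  have : conicCombinations g B A = ⋃ L ∈ {L : Finset κ | L ⊆ A ∧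
      LinearIndepOn ℝ g ((B ∪ L : Finset κ) : Set κ)}, conicCombinations g B L := by
    ext x
    simp only [mem_iUnion, mem_ofPred_eq, exists_prop]
    constructor
    · rintro ⟨c, hc, rfl⟩
      obtain ⟨L, hL, hLI, d, hd, hsum⟩ := exists_pos_combination hB A hBA c hc
      exact ⟨L, ⟨hL, hLI⟩, d, fun i hi => (hd i hi).le, hsum⟩
    · rintro ⟨L, ⟨hL, -⟩, c, hc, rfl⟩
      -- The values of `c` on `A` outside `L` have no prescribed sign, so they are replaced by `0`.
      refine ⟨fun i => if i ∈ B ∪ L then c i else 0, fun i hi => ?_, ?_⟩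
      · dsimp only
        split_ifs with h
        · refine hc i ((Finset.mem_union.1 h).resolve_left fun hiB => ?_)
          exact Finset.disjoint_left.1 hBA hiB hi
        · exact le_rfl
      · rw [← Finset.sum_subset (Finset.union_subset_union_right (s := B) hL)]
        · exact Finset.sum_congr rfl fun i hi => by simp only [if_pos hi]
        · exact fun i _ hi => by simp only [if_neg hi, zero_smul]
  rw [this]
  refine Set.Finite.isClosed_biUnion ?_ fun L hL => isClosed_conicCombinations_of_linearIndepOn hL.2
  exact (A.powerset.finite_toSet).subset fun L hL => Finset.mem_coe.2 (Finset.mem_powerset.2 hL.1)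

/-- Farkas' lemma for finitely many equalities and inequalities in a Hilbert space. -/
theorem mem_conicCombinations_of_forall_inner_nonpos [NormedAddCommGroup H] [InnerProductSpace ℝ H]
    [CompleteSpace H] {g : κ → H} {B A : Finset κ} (hB : LinearIndepOn ℝ g (B : Set κ))
    (hBA : Disjoint B A) {h : H}
    (hh : ∀ d : H, (∀ i ∈ B, inner ℝ d (g i) = 0) → (∀ i ∈ A, inner ℝ d (g i) ≤ 0) →
      inner ℝ h d ≤ 0) :
    h ∈ conicCombinations g B A := by
  by_contra hnot
  obtain ⟨φ, u, hu, hφ⟩ := geometric_hahn_banach_closed_point (convex_conicCombinations g B A)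
    (isClosed_conicCombinations hB hBA) hnot
  have hu0 : 0 < u := by
    simpa using hu 0 ⟨0, fun _ _ => le_rfl, by simp⟩
  -- The cone contains whole rays (lines for `i ∈ B`), and `φ` is bounded above on it; taking `s = u
  -- / φ (g i)` then forces the signs of `φ (g i)`.
  have key : ∀ i ∈ B ∪ A, ∀ s : ℝ, (i ∈ A → 0 ≤ s) → s * φ (g i) < u := by
    intro i hi s hs
    have := hu (s • g i) ⟨fun j => if j = i then s else 0, fun j hj => ?_, ?_⟩
    · simpa using this
    · dsimp only
      split_ifs with hji
      · exact hs (hji ▸ hj)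
      · exact le_rfl
    · rw [Finset.sum_eq_single i]
      · simp
      · exact fun j _ hji => by simp [hji]
      · exact fun h => absurd hi h
  have hpos : ∀ i ∈ B ∪ A, φ (g i) ≤ 0 := by
    intro i hi
    by_contra! hlt
    have := key i hi (u / φ (g i)) fun _ => by positivity
    rw [div_mul_cancel₀ _ hlt.ne'] at this
    exact lt_irrefl _ this
  have hzero : ∀ i ∈ B, φ (g i) = 0 := by
    intro i hi
    by_contra hne
    have := key i (Finset.mem_union_left _ hi) (u / φ (g i))
      fun hiA => absurd hiA (Finset.disjoint_left.1 hBA hi)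
    rw [div_mul_cancel₀ _ hne] at this
    exact lt_irrefl _ this
  have hd : ∀ y, inner ℝ ((InnerProductSpace.toDual ℝ H).symm φ) y = φ y := fun y =>
    InnerProductSpace.toDual_symm_apply
  -- The Riesz representative of `φ` is a feasible direction on which `h` is positive.
  have := hh ((InnerProductSpace.toDual ℝ H).symm φ) (fun i hi => by rw [hd, hzero i hi])
    (fun i hi => by rw [hd]; exact hpos i (Finset.mem_union_right _ hi))
  rw [real_inner_comm, hd] at this
  linarith

end ConicCombinations

/-! ### Coefficient bounds that persist under perturbation. -/

section UniformIndependence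

variable {κ H X : Type*} [NormedAddCommGroup H] [NormedSpace ℝ H]

/-- An injective linear map from a finite-dimensional space is antilipschitz. -/
theorem LinearIndepOn.exists_abs_coeff_le {g : κ → H} {J : Finset κ}
    (h : LinearIndepOn ℝ g (J : Set κ)) :
    ∃ k > 0, ∀ c : κ → ℝ, ∀ i ∈ J, |c i| ≤ k * ‖∑ j ∈ J, c j • g j‖ := by
  have hinj := h.linearIndependent.fintypeLinearCombination_injective
  obtain ⟨k, hk, hanti⟩ := LinearMap.exists_antilipschitzWith _ (LinearMap.ker_eq_bot.2 hinj)
  refine ⟨k, hk, fun c i hi => ?_⟩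
  have h1 := hanti.le_mul_norm (map_zero _) (fun i : (J : Set κ) => c i)
  rw [Fintype.linearCombination_apply] at h1
  have h2 : ∑ j : (J : Set κ), c j • g j = ∑ j ∈ J, c j • g j :=
    Finset.sum_coe_sort J (fun i => c i • g i)
  rw [h2] at h1
  exact (norm_le_pi_norm (fun i : (J : Set κ) => c i) ⟨i, hi⟩).trans h1

/-- Near a point where the vectors are linearly independent, the coefficients of a linear
combination are bounded by its norm, uniformly in the parameter. -/
theorem LinearIndepOn.eventually_abs_coeff_le [TopologicalSpace X] {g : κ → X → H} {x₀ : X}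
    {J : Finset κ} (hg : ∀ i ∈ J, ContinuousAt (g i) x₀)
    (h : LinearIndepOn ℝ (fun i => g i x₀) (J : Set κ)) :
    ∃ k > 0, ∀ᶠ x in 𝓝 x₀, ∀ c : κ → ℝ, ∀ i ∈ J, |c i| ≤ k * ‖∑ j ∈ J, c j • g j x‖ := by
  obtain ⟨k, hk, hbound⟩ := h.exists_abs_coeff_le
  refine ⟨2 * k, by positivity, ?_⟩
  have htend : Tendsto (fun x => ∑ j ∈ J, ‖g j x - g j x₀‖) (𝓝 x₀) (𝓝 0) := by
    rw [← Finset.sum_const_zero (s := J)]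
    refine tendsto_finsetSum J fun j hj => ?_
    simpa using ((hg j hj).sub (continuousAt_const (y := g j x₀))).norm.tendsto
  filter_upwards [htend.eventually_lt_const (show (0 : ℝ) < 1 / (2 * k) by positivity)] with x hx
  intro c i hi
  -- At the largest coefficient the perturbation error is at most `|c m| / 2` after multiplication
  -- by `k`, so it is absorbed on the left; hence the constant `2 * k`.
  obtain ⟨m, hm, hmax⟩ := Finset.exists_max_image J (fun j => |c j|) ⟨i, hi⟩
  have h1 := hbound c m hm
  have h2 : ‖∑ j ∈ J, c j • g j x₀‖ ≤ ‖∑ j ∈ J, c j • g j x‖ + |c m| * (1 / (2 * k)) := by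
    have e : ∑ j ∈ J, c j • g j x₀ = ∑ j ∈ J, c j • g j x - ∑ j ∈ J, c j • (g j x - g j x₀) := by
      simp only [smul_sub, Finset.sum_sub_distrib, sub_sub_cancel]
    rw [e]
    refine (norm_sub_le _ _).trans (add_le_add_right ?_ _)
    calc ‖∑ j ∈ J, c j • (g j x - g j x₀)‖ ≤ ∑ j ∈ J, |c m| * ‖g j x - g j x₀‖ := by
          refine norm_sum_le_of_le _ fun j hj => ?_
          rw [norm_smul, Real.norm_eq_abs]
          exact mul_le_mul_of_nonneg_right (hmax j hj) (norm_nonneg _)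
      _ ≤ |c m| * (1 / (2 * k)) := by
          rw [← Finset.mul_sum]
          exact mul_le_mul_of_nonneg_left hx.le (abs_nonneg _)
  have h3 : |c m| ≤ k * ‖∑ j ∈ J, c j • g j x‖ + |c m| / 2 := by
    calc |c m| ≤ k * (‖∑ j ∈ J, c j • g j x‖ + |c m| * (1 / (2 * k))) :=
          h1.trans (mul_le_mul_of_nonneg_left h2 hk.le)
      _ = _ := by field_simp
  have := hmax i hi
  linarith

theorem linearIndepOn_of_abs_coeff_le {g : κ → H} {J : Finset κ} {k : ℝ}
    (h : ∀ c : κ → ℝ, ∀ i ∈ J, |c i| ≤ k * ‖∑ j ∈ J, c j • g j‖) :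
    LinearIndepOn ℝ g (J : Set κ) := by
  rw [linearIndepOn_finset_iff]
  intro c hc i hi
  simpa [hc] using h c i hi

end UniformIndependence

theorem linearIndepOn_iff_card_eq_finrank {κ H : Type*} [AddCommGroup H] [Module ℝ H] {g : κ → H}
    {J : Finset κ} :
    LinearIndepOn ℝ g (J : Set κ) ↔ J.card = Set.finrank ℝ (g '' (J : Set κ)) := by
  rw [LinearIndepOn, linearIndependent_iff_card_eq_finrank_span, Set.image_eq_range,
    ← Fintype.card_coe J]
  rfl

/-! ### Parametric linear systems: normal cones, uniform bounds, Lipschitz projection. -/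

namespace ConstraintSystem

variable {G : Type*} [NormedAddCommGroup G] {D : Set G}
  {H : Type*} [NormedAddCommGroup H] [InnerProductSpace ℝ H] {κ : Type*}

theorem convex_sol (S : ConstraintSystem D H κ) (p : D) : Convex ℝ (S.sol p) := by
  intro x hx y hy a b ha hb hab
  refine ⟨fun i hi => ?_, fun i hi => ?_⟩
  · rw [inner_add_left, real_inner_smul_left, real_inner_smul_left, hx.1 i hi, hy.1 i hi,
      ← add_mul, hab, one_mul]
  · rw [inner_add_left, real_inner_smul_left, real_inner_smul_left]
    calc a * inner ℝ x (S.g i p) + b * inner ℝ y (S.g i p) ≤ a * S.f i p + b * S.f i p :=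
          add_le_add (mul_le_mul_of_nonneg_left (hx.2 i hi) ha)
            (mul_le_mul_of_nonneg_left (hy.2 i hi) hb)
      _ = S.f i p := by rw [← add_mul, hab, one_mul]

theorem isClosed_sol (S : ConstraintSystem D H κ) (p : D) : IsClosed (S.sol p) := by
  have : S.sol p = (⋂ i ∈ S.I₁, {x : H | inner ℝ x (S.g i p) = S.f i p}) ∩
      ⋂ i ∈ S.I₂, {x : H | inner ℝ x (S.g i p) ≤ S.f i p} := by
    ext x
    simp [sol]
  rw [this]
  refine (isClosed_biInter fun i _ => ?_).inter (isClosed_biInter fun i _ => ?_)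
  · exact isClosed_eq (by fun_prop) continuous_const
  · exact isClosed_le (by fun_prop) continuous_const

theorem coe_I₁_subset_active (S : ConstraintSystem D H κ) {p : D} {x : H} (hx : x ∈ S.sol p) :
    (S.I₁ : Set κ) ⊆ S.active p x := fun i hi => hx.1 i hi

/-- Inactive constraints are strict at `x`, and finitely many strict inequalities survive a small
step. -/
theorem eventually_add_smul_mem_sol [Finite κ] (S : ConstraintSystem D H κ) {p : D} {x : H}
    (hx : x ∈ S.sol p) {d : H} (h₁ : ∀ i ∈ S.I₁, inner ℝ d (S.g i p) = 0)
    (h₂ : ∀ i ∈ S.active p x ∩ S.I₂, inner ℝ d (S.g i p) ≤ 0) :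
    ∀ᶠ t : ℝ in 𝓝[>] 0, x + t • d ∈ S.sol p := by
  have hin : ∀ i, ∀ᶠ t : ℝ in 𝓝[>] 0, i ∈ S.I₂ → inner ℝ (x + t • d) (S.g i p) ≤ S.f i p := by
    intro i
    by_cases hi : i ∈ S.I₂
    swap
    · exact Eventually.of_forall fun t h => absurd h hi
    by_cases ha : i ∈ S.active p x
    · filter_upwards [self_mem_nhdsWithin] with t ht _
      have hle := h₂ i ⟨ha, hi⟩
      rw [inner_add_left, real_inner_smul_left, show inner ℝ x (S.g i p) = S.f i p from ha]
      have := mul_nonpos_of_nonneg_of_nonpos (le_of_lt (show 0 < t from ht)) hle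
      linarith
    · have hlt : inner ℝ x (S.g i p) < S.f i p := lt_of_le_of_ne (hx.2 i hi) ha
      have hcont : Continuous fun t : ℝ => inner ℝ (x + t • d) (S.g i p) := by fun_prop
      have hev : ∀ᶠ t : ℝ in 𝓝 0, inner ℝ (x + t • d) (S.g i p) < S.f i p :=
        (hcont.tendsto 0).eventually_lt_const (by simpa using hlt)
      filter_upwards [hev.filter_mono nhdsWithin_le_nhds] with t ht _ using ht.le
  filter_upwards [eventually_all.2 hin] with t ht
  refine ⟨fun i hi => ?_, ht⟩
  rw [inner_add_left, real_inner_smul_left, h₁ i hi, mul_zero, add_zero, hx.1 i hi]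

/-- Normal vectors to the solution set are combinations of active gradients. Any linearly
independent family of gradients containing those of the equality constraints may be used with free
coefficients, the remaining gradients being active and having positive coefficients. -/
theorem exists_multipliers [CompleteSpace H] [Fintype κ] [DecidableEq κ]
    (S : ConstraintSystem D H κ) {p : D} {x h : H} (hx : x ∈ S.sol p)
    (hh : h ∈ normalConeAt (S.sol p) x) {B : Finset κ} (hI : S.I₁ ⊆ B)
    (hB : LinearIndepOn ℝ (fun i => S.g i p) (B : Set κ)) :
    ∃ L : Finset κ, (L : Set κ) ⊆ S.active p x \ (B : Set κ) ∧
      LinearIndepOn ℝ (fun i => S.g i p) ((B ∪ L : Finset κ) : Set κ) ∧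
      ∃ c : κ → ℝ, (∀ i ∈ L, 0 < c i) ∧ h = ∑ i ∈ B ∪ L, c i • S.g i p := by
  classical
  set A : Finset κ := Finset.univ.filter fun i => i ∈ S.active p x ∧ i ∉ B with hA
  have hBA : Disjoint B A := Finset.disjoint_left.2 fun i hi hiA =>
    (Finset.mem_filter.1 hiA).2.2 hi
  have hmem : h ∈ conicCombinations (fun i => S.g i p) B A := by
    refine mem_conicCombinations_of_forall_inner_nonpos hB hBA fun d hd₁ hd₂ => ?_
    have hev := S.eventually_add_smul_mem_sol hx (d := d) (fun i hi => hd₁ i (hI hi)) (by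
      rintro i ⟨hi, -⟩
      by_cases hiB : i ∈ B
      · exact (hd₁ i hiB).le
      · exact hd₂ i (Finset.mem_filter.2 ⟨Finset.mem_univ i, hi, hiB⟩))
    obtain ⟨t, ht, htpos⟩ := (hev.and self_mem_nhdsWithin).exists
    have := hh _ ht
    rw [add_sub_cancel_left, real_inner_smul_right] at this
    exact nonpos_of_mul_nonpos_right this htpos
  obtain ⟨c, hc, hsum⟩ := hmem
  obtain ⟨L, hL, hLI, d, hd, hsum'⟩ := exists_pos_combination hB A hBA c hc
  refine ⟨L, fun i hi => ?_, hLI, d, hd, (hsum'.trans hsum).symm⟩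
  have := (Finset.mem_filter.1 (hL hi)).2
  exact ⟨this.1, fun h => this.2 h⟩

theorem eventually_active_subset [Finite κ] (S : ConstraintSystem D H κ) (p₀ : D) (x₀ : H) :
    ∀ᶠ z : D × H in 𝓝 (p₀, x₀), S.active z.1 z.2 ⊆ S.active p₀ x₀ := by
  have : ∀ i, ∀ᶠ z : D × H in 𝓝 (p₀, x₀), i ∈ S.active z.1 z.2 → i ∈ S.active p₀ x₀ := by
    intro i
    by_cases hi : i ∈ S.active p₀ x₀
    · exact Eventually.of_forall fun _ _ => hi
    have hg := (S.g_lipschitz i).continuous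
    have hf := (S.f_lipschitz i).continuous
    have h₁ : Continuous fun z : D × H => inner ℝ z.2 (S.g i z.1) := by fun_prop
    have h₂ : Continuous fun z : D × H => S.f i z.1 := by fun_prop
    filter_upwards [(isOpen_ne_fun h₁ h₂).mem_nhds hi] with z hz h
    exact absurd h hz
  filter_upwards [eventually_all.2 this] with z hz i hi using hz i hi

theorem exists_active_subset_of_near [Finite κ] (S : ConstraintSystem D H κ) (p₀ : D) (x₀ : H) :
    ∃ r > 0, ∀ᶠ p in 𝓝 p₀, ∀ x ∈ Metric.ball x₀ r, S.active p x ⊆ S.active p₀ x₀ := by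
  have h := S.eventually_active_subset p₀ x₀
  rw [nhds_prod_eq] at h
  obtain ⟨P, hP, Q, hQ, hPQ⟩ := eventually_prod_iff.1 h
  obtain ⟨r, hr, hball⟩ := Metric.eventually_nhds_iff_ball.1 hQ
  refine ⟨r, hr, ?_⟩
  filter_upwards [hP] with p hp x hx using hPQ hp (hball x hx)

/-- A common bound for the coefficients of all linear combinations of gradients which are linearly
independent at the reference parameter. -/
theorem exists_uniform_abs_coeff_le [Finite κ] (S : ConstraintSystem D H κ) (p₀ : D) :
    ∃ k > 0, ∀ᶠ p in 𝓝 p₀, ∀ J : Finset κ,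
      LinearIndepOn ℝ (fun i => S.g i p₀) (J : Set κ) →
      ∀ c : κ → ℝ, ∀ i ∈ J, |c i| ≤ k * ‖∑ j ∈ J, c j • S.g j p‖ := by
  classical
  have := Fintype.ofFinite κ
  have hex : ∀ J : Finset κ, ∃ k > 0, ∀ᶠ p in 𝓝 p₀,
      LinearIndepOn ℝ (fun i => S.g i p₀) (J : Set κ) →
      ∀ c : κ → ℝ, ∀ i ∈ J, |c i| ≤ k * ‖∑ j ∈ J, c j • S.g j p‖ := by
    intro J
    by_cases hJ : LinearIndepOn ℝ (fun i => S.g i p₀) (J : Set κ)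
    · obtain ⟨k, hk, hev⟩ := hJ.eventually_abs_coeff_le
        fun i _ => (S.g_lipschitz i).continuous.continuousAt
      exact ⟨k, hk, hev.mono fun p hp _ => hp⟩
    · exact ⟨1, one_pos, Eventually.of_forall fun p h => absurd h hJ⟩
  choose k hk hev using hex
  refine ⟨∑ J, k J, Finset.sum_pos (fun J _ => hk J) ⟨∅, Finset.mem_univ _⟩, ?_⟩
  filter_upwards [eventually_all.2 hev] with p hp J hJ c i hi
  exact (hp J hJ c i hi).trans (mul_le_mul_of_nonneg_right
    (Finset.single_le_sum (f := k) (fun J _ => (hk J).le) (Finset.mem_univ J)) (norm_nonneg _))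

theorem exists_lipschitz_data [Finite κ] (S : ConstraintSystem D H κ) (p₀ : D) :
    ∃ C : ℝ, 0 ≤ C ∧ ∃ U ∈ 𝓝 p₀, ∀ p ∈ U, ∀ q ∈ U, ∀ i,
      ‖S.g i p - S.g i q‖ ≤ C * ‖(p : G) - (q : G)‖ ∧
      |S.f i p - S.f i q| ≤ C * ‖(p : G) - (q : G)‖ := by
  have := Fintype.ofFinite κ
  choose a s hs hga using fun i => S.g_lipschitz i p₀
  choose b t ht hfb using fun i => S.f_lipschitz i p₀
  refine ⟨∑ i, ((a i : ℝ) + b i), Finset.sum_nonneg fun i _ => by positivity,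
    ⋂ i, s i ∩ t i, iInter_mem.2 fun i => inter_mem (hs i) (ht i), fun p hp q hq i => ?_⟩
  have hle : (a i : ℝ) + b i ≤ ∑ i, ((a i : ℝ) + b i) :=
    Finset.single_le_sum (f := fun i => (a i : ℝ) + b i) (fun i _ => by positivity)
      (Finset.mem_univ i)
  have ha : (0 : ℝ) ≤ a i := (a i).2
  have hb : (0 : ℝ) ≤ b i := (b i).2
  have h₁ := (hga i).dist_le_mul p (mem_iInter.1 hp i).1 q (mem_iInter.1 hq i).1
  have h₂ := (hfb i).dist_le_mul p (mem_iInter.1 hp i).2 q (mem_iInter.1 hq i).2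
  rw [Subtype.dist_eq, dist_eq_norm, dist_eq_norm] at h₁
  rw [Subtype.dist_eq, Real.dist_eq, dist_eq_norm] at h₂
  exact ⟨h₁.trans (mul_le_mul_of_nonneg_right (by linarith) (norm_nonneg _)),
    h₂.trans (mul_le_mul_of_nonneg_right (by linarith) (norm_nonneg _))⟩

/-- Independence means that the rank equals the cardinality, and the rank is the same at `p` and at
`p₀`. Continuity alone gives only the opposite implication. -/
theorem RCRCQ.eventually_linearIndepOn {S : ConstraintSystem D H κ} {p₀ : D} {x₀ : H}
    (hS : S.RCRCQ p₀ x₀) :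
    ∀ᶠ p in 𝓝 p₀, ∀ J : Finset κ, S.I₁ ⊆ J → (J : Set κ) ⊆ S.active p₀ x₀ →
      LinearIndepOn ℝ (fun i => S.g i p) (J : Set κ) →
      LinearIndepOn ℝ (fun i => S.g i p₀) (J : Set κ) := by
  obtain ⟨-, U, hU, hrank⟩ := hS
  filter_upwards [hU] with p hp J hI hJ hLI
  rw [linearIndepOn_iff_card_eq_finrank] at hLI ⊢
  rw [hLI, hrank J hI hJ p hp]

theorem mem_sol_tighten [DecidableEq κ] {S : ConstraintSystem D H κ} {p : D} {x : H}
    (hx : x ∈ S.sol p) {T : Finset κ} (hT : (T : Set κ) ⊆ S.active p x) :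
    x ∈ (S.tighten T).sol p := by
  refine ⟨fun i hi => ?_, fun i hi => hx.2 i fun h => hi (Finset.mem_union_left _ h)⟩
  rcases Finset.mem_union.1 hi with h | h
  · exact hx.1 i h
  · exact hT h

/-- Tightening leaves gradients and active sets unchanged and only shrinks the family of sets `J` to
be tested. -/
theorem RCRCQ.tighten [DecidableEq κ] {S : ConstraintSystem D H κ} {p₀ : D} {x₀ : H}
    (hS : S.RCRCQ p₀ x₀) {T : Finset κ} (hT : (T : Set κ) ⊆ S.active p₀ x₀) :
    (S.tighten T).RCRCQ p₀ x₀ := by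
  obtain ⟨hx, U, hU, hrank⟩ := hS
  exact ⟨mem_sol_tighten hx hT, U, hU,
    fun J hI hJ => hrank J (Finset.union_subset_left hI) hJ⟩

/-- Under the relaxed constant rank constraint qualification, a solution map whose lower
Kuratowski limit contains the reference point is Lipschitz-like there. -/
theorem RCRCQ.exists_lipschitz_selection [CompleteSpace H] [Finite κ] {S : ConstraintSystem D H κ}
    {p₀ : D} {x₀ : H} (hS : S.RCRCQ p₀ x₀)
    (hLI : LinearIndepOn ℝ (fun i => S.g i p₀) (S.I₁ : Set κ))
    (hlim : MemKuratowskiLiminf S.sol p₀ x₀) :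
    ∃ ℓ > 0, ∃ U ∈ 𝓝 p₀, ∃ r > 0, ∀ p₁ ∈ U, ∀ p₂ ∈ U, ∀ x₁ ∈ S.sol p₁, ‖x₁ - x₀‖ < r →
      ∃ x₂ ∈ S.sol p₂, ‖x₁ - x₂‖ ≤ ℓ * ‖(p₁ : G) - (p₂ : G)‖ := by
  classical
  have := Fintype.ofFinite κ
  obtain ⟨ρ, hρ, hact⟩ := S.exists_active_subset_of_near p₀ x₀
  obtain ⟨k, hk, hcoeff⟩ := S.exists_uniform_abs_coeff_le p₀
  obtain ⟨C, hC, W, hW, hlip⟩ := S.exists_lipschitz_data p₀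
  obtain ⟨W', hW', hne⟩ := hlim (Metric.ball x₀ (ρ / 4)) (Metric.ball_mem_nhds _ (by positivity))
  -- `‖x₀‖ + 1` bounds `‖x₁‖` against the variation of `g`; the further `1` accounts for the
  -- variation of `f`.
  set M : ℝ := k * ((‖x₀‖ + 2) * C) with hM
  have hM0 : 0 ≤ M := by positivity
  refine ⟨Fintype.card κ * M + 1, by positivity, _,
    (inter_mem hW (inter_mem hW' (hact.and (hcoeff.and hS.eventually_linearIndepOn)))),
    min 1 (ρ / 4), by positivity, ?_⟩
  rintro p₁ ⟨hp₁, -⟩ p₂ ⟨hp₂, hp₂', hact₂, hcoeff₂, hind₂⟩ x₁ hx₁ hx₁r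
  obtain ⟨hr₁, hr₂⟩ := lt_min_iff.1 hx₁r
  obtain ⟨y, hyball, hy⟩ := hne p₂ hp₂'
  obtain ⟨x₂, hx₂, hproj⟩ := exists_norm_eq_iInf_of_complete_convex ⟨y, hy⟩
    (S.isClosed_sol p₂).isComplete (S.convex_sol p₂) x₁
  have hnormal : x₁ - x₂ ∈ normalConeAt (S.sol p₂) x₂ :=
    (norm_eq_iInf_iff_real_inner_le_zero (S.convex_sol p₂) hx₂).1 hproj
  refine ⟨x₂, hx₂, ?_⟩
  have hle : ‖x₁ - x₂‖ ≤ ‖x₁ - y‖ := by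
    rw [hproj]
    exact ciInf_le ⟨0, by rintro _ ⟨w, rfl⟩; exact norm_nonneg _⟩ (⟨y, hy⟩ : S.sol p₂)
  rw [mem_ball_iff_norm] at hyball
  -- Both `x₁` and `y` lie within `ρ / 4` of `x₀`, so the projection lies within `3 * ρ / 4`.
  have hx₂ball : x₂ ∈ Metric.ball x₀ ρ := by
    rw [mem_ball_iff_norm]
    have h₁ := norm_sub_le_norm_sub_add_norm_sub x₁ x₀ y
    have h₂ := norm_sub_le_norm_sub_add_norm_sub x₂ x₁ x₀
    rw [norm_sub_rev x₂ x₁] at h₂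
    rw [norm_sub_rev x₀ y] at h₁
    linarith
  have hsub := hact₂ x₂ hx₂ball
  have hLI₂ : LinearIndepOn ℝ (fun i => S.g i p₂) (S.I₁ : Set κ) :=
    linearIndepOn_of_abs_coeff_le (hcoeff₂ S.I₁ hLI)
  obtain ⟨L, hL, hLIL, c, hc, hsum⟩ := S.exists_multipliers hx₂ hnormal subset_rfl hLI₂
  have hJact : ∀ i ∈ S.I₁ ∪ L, i ∈ S.active p₂ x₂ := fun i hi =>
    (Finset.mem_union.1 hi).elim (fun h => S.coe_I₁_subset_active hx₂ h) fun h => (hL h).1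
  have hbound := hcoeff₂ _ (hind₂ _ Finset.subset_union_left
    (fun i hi => hsub (hJact i hi)) hLIL) c
  rw [← hsum] at hbound
  set N := ‖x₁ - x₂‖
  set δ := ‖(p₁ : G) - (p₂ : G)‖
  have hx₁norm : ‖x₁‖ ≤ ‖x₀‖ + 1 := by
    have := norm_le_norm_add_norm_sub' x₁ x₀
    linarith
  have hterm : ∀ i ∈ S.I₁ ∪ L, c i * inner ℝ (x₁ - x₂) (S.g i p₂) ≤ M * δ * N := by
    intro i hi
    have hactive : inner ℝ x₂ (S.g i p₂) = S.f i p₂ := hJact i hi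
    -- The first bracket is the residual of `x₁` at `p₁`: zero for equalities, nonpositive for
    -- inequalities, where `c i > 0`. The rest is the variation of the data.
    have hsplit : inner ℝ (x₁ - x₂) (S.g i p₂) =
        (inner ℝ x₁ (S.g i p₁) - S.f i p₁) +
          (-inner ℝ x₁ (S.g i p₁ - S.g i p₂) + (S.f i p₁ - S.f i p₂)) := by
      rw [inner_sub_left, hactive, inner_sub_right]
      ring
    have hfirst : c i * (inner ℝ x₁ (S.g i p₁) - S.f i p₁) ≤ 0 := by
      by_cases hi₁ : i ∈ S.I₁
      · rw [hx₁.1 i hi₁, sub_self, mul_zero]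
      · exact mul_nonpos_of_nonneg_of_nonpos
          (hc i ((Finset.mem_union.1 hi).resolve_left hi₁)).le (sub_nonpos.2 (hx₁.2 i hi₁))
    have hsecond : |-inner ℝ x₁ (S.g i p₁ - S.g i p₂) + (S.f i p₁ - S.f i p₂)| ≤
        (‖x₀‖ + 2) * C * δ := by
      obtain ⟨hg, hf⟩ := hlip p₁ hp₁ p₂ hp₂ i
      calc _ ≤ |-inner ℝ x₁ (S.g i p₁ - S.g i p₂)| + |S.f i p₁ - S.f i p₂| := abs_add_le _ _
        _ ≤ (‖x₀‖ + 1) * (C * δ) + C * δ := by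
          refine add_le_add ?_ hf
          rw [abs_neg]
          exact (abs_real_inner_le_norm _ _).trans
            (mul_le_mul hx₁norm hg (norm_nonneg _) (by positivity))
        _ = _ := by ring
    rw [hsplit, mul_add]
    calc _ ≤ 0 + |c i| * |-inner ℝ x₁ (S.g i p₁ - S.g i p₂) + (S.f i p₁ - S.f i p₂)| :=
          add_le_add hfirst ((le_abs_self _).trans (abs_mul _ _).le)
      _ ≤ 0 + k * N * ((‖x₀‖ + 2) * C * δ) :=
          add_le_add_right (mul_le_mul (hbound i hi) hsecond (abs_nonneg _) (by positivity)) _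
      _ = M * δ * N := by rw [hM]; ring
  have hsq : N * N ≤ Fintype.card κ * M * δ * N := by
    calc N * N = inner ℝ (x₁ - x₂) (x₁ - x₂) := (real_inner_self_eq_norm_mul_norm _).symm
      _ = ∑ i ∈ S.I₁ ∪ L, c i * inner ℝ (x₁ - x₂) (S.g i p₂) := by
          nth_rewrite 2 [hsum]
          simp only [inner_sum, real_inner_smul_right]
      _ ≤ (S.I₁ ∪ L).card • (M * δ * N) := Finset.sum_le_card_nsmul _ _ _ hterm
      _ ≤ Fintype.card κ • (M * δ * N) :=
          nsmul_le_nsmul_left (by positivity) (Finset.card_le_univ _)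
      _ = _ := by rw [nsmul_eq_mul]; ring
  have hδ : 0 ≤ δ := norm_nonneg _
  rcases (norm_nonneg (x₁ - x₂)).eq_or_lt with h0 | hpos
  · have h0' : N = 0 := h0.symm
    rw [h0']
    positivity
  · have := le_of_mul_le_mul_right hsq hpos
    linarith

end ConstraintSystem

/-! ### Tightened systems and stability of multipliers. -/

namespace ConstraintSystem

variable {G : Type*} [NormedAddCommGroup G] {D : Set G}
  {H : Type*} [NormedAddCommGroup H] [InnerProductSpace ℝ H] {κ : Type*} [DecidableEq κ]

theorem IsAdmissible.union_subset_active {R : ConstraintSystem D H κ} {p₀ : D} {x₀ : H}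
    {K L : Finset κ} (hL : R.IsAdmissible p₀ x₀ K L) (hK : (K : Set κ) ⊆ R.active p₀ x₀) :
    ((K ∪ L : Finset κ) : Set κ) ⊆ R.active p₀ x₀ := by
  rw [Finset.coe_union]
  exact union_subset hK fun i hi => (hL.1 hi).1.1

theorem exists_lipschitz_selection_tighten [CompleteSpace H] [Finite κ]
    {R : ConstraintSystem D H κ} {p₀ : D} {x₀ : H} (hR : R.RCRCQ p₀ x₀) {K : Finset κ}
    (hK : (K : Set κ) ⊆ R.active p₀ x₀)
    (hlim : ∀ L : Finset κ, R.IsAdmissible p₀ x₀ K L →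
      MemKuratowskiLiminf (R.tighten (K ∪ L)).sol p₀ x₀) :
    ∃ ℓ > 0, ∃ U ∈ 𝓝 p₀, ∃ V ∈ 𝓝 (0 : H), ∀ L : Finset κ, R.IsAdmissible p₀ x₀ K L →
      ∀ p₁ ∈ U, ∀ p₂ ∈ U, ∀ x₁ ∈ (R.tighten (K ∪ L)).sol p₁, x₁ - x₀ ∈ V →
        ∃ x₂ ∈ (R.tighten (K ∪ L)).sol p₂, ‖x₁ - x₂‖ ≤ ℓ * ‖(p₁ : G) - (p₂ : G)‖ := by
  have := Fintype.ofFinite κ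
  have hex : ∀ L : Finset κ, ∃ ℓ > 0, ∃ U ∈ 𝓝 p₀, ∃ r > 0, R.IsAdmissible p₀ x₀ K L →
      ∀ p₁ ∈ U, ∀ p₂ ∈ U, ∀ x₁ ∈ (R.tighten (K ∪ L)).sol p₁, ‖x₁ - x₀‖ < r →
        ∃ x₂ ∈ (R.tighten (K ∪ L)).sol p₂, ‖x₁ - x₂‖ ≤ ℓ * ‖(p₁ : G) - (p₂ : G)‖ := by
    intro L
    by_cases hL : R.IsAdmissible p₀ x₀ K L
    · have hLI : LinearIndepOn ℝ (fun i => (R.tighten (K ∪ L)).g i p₀)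
          ((R.tighten (K ∪ L)).I₁ : Set κ) := by
        have h := hL.2
        rw [Finset.union_assoc] at h
        exact h
      obtain ⟨ℓ, hℓ, U, hU, r, hr, h⟩ :=
        (hR.tighten (hL.union_subset_active hK)).exists_lipschitz_selection hLI (hlim L hL)
      exact ⟨ℓ, hℓ, U, hU, r, hr, fun _ => h⟩
    · exact ⟨1, one_pos, univ, univ_mem, 1, one_pos, fun h => absurd h hL⟩
  choose ℓ hℓ U hU r hr h using hex
  -- Summing the moduli over all finite index sets gives one modulus for every `L`.
  refine ⟨∑ L, ℓ L, Finset.sum_pos (fun L _ => hℓ L) ⟨∅, Finset.mem_univ _⟩, ⋂ L, U L,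
    iInter_mem.2 hU, ⋂ L, Metric.ball 0 (r L),
    iInter_mem.2 fun L => Metric.ball_mem_nhds _ (hr L), ?_⟩
  intro L hL p₁ hp₁ p₂ hp₂ x₁ hx₁ hx₁V
  obtain ⟨x₂, hx₂, hle⟩ := h L hL p₁ (mem_iInter.1 hp₁ L) p₂ (mem_iInter.1 hp₂ L) x₁ hx₁
    (mem_ball_zero_iff.1 (mem_iInter.1 hx₁V L))
  exact ⟨x₂, hx₂, hle.trans (mul_le_mul_of_nonneg_right
    (Finset.single_le_sum (f := ℓ) (fun L _ => (hℓ L).le) (Finset.mem_univ L)) (norm_nonneg _))⟩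

/-- Stability of multipliers: normal vectors close to `v₀ - x₀` at nearby points have multipliers
close to those of a representation of `v₀ - x₀` with linearly independent gradients. -/
theorem exists_multipliers_near [CompleteSpace H] [Finite κ]
    {R : ConstraintSystem D H κ} {p₀ : D} {v₀ x₀ : H} (hR : R.RCRCQ p₀ x₀) {K : Finset κ}
    {μ : κ → ℝ} (hμ : R.IsMultiplierRepresentation p₀ v₀ x₀ K μ) {ε : ℝ} (hε : 0 < ε) :
    ∃ U ∈ 𝓝 p₀, ∃ V ∈ 𝓝 (0 : H), ∀ p ∈ U, ∀ x x' : H, (x, x') ∈ normalConeGraph (R.sol p) →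
      x - x₀ ∈ V → x' - (v₀ - x₀) ∈ V →
      ∃ L : Finset κ,
        (L : Set κ) ⊆ (R.active p x ∩ R.I₂) \ (K : Set κ) ∧
        (R.active p x ∩ R.I₂) \ (K : Set κ) ⊆ (R.active p₀ x₀ ∩ R.I₂) \ (K : Set κ) ∧
        R.IsAdmissible p₀ x₀ K L ∧
        ∃ lam : κ → ℝ,
          x' = ∑ i ∈ R.I₁ ∪ K ∪ L, lam i • R.g i p ∧
          (∀ i ∈ R.I₁ ∪ K, μ i - ε ≤ lam i ∧ lam i ≤ μ i + ε) ∧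
          (∀ i ∈ L, 0 < lam i ∧ lam i ≤ ε) := by
  have := Fintype.ofFinite κ
  obtain ⟨ρ, hρ, hact⟩ := R.exists_active_subset_of_near p₀ x₀
  obtain ⟨k, hk, hcoeff⟩ := R.exists_uniform_abs_coeff_le p₀
  set w : D → H := fun p => ∑ i ∈ R.I₁ ∪ K, μ i • R.g i p with hw
  have hwcont : Continuous w :=
    continuous_finsetSum _ fun i _ => (R.g_lipschitz i).continuous.const_smul _
  have hwnear : ∀ᶠ p in 𝓝 p₀, w p ∈ Metric.ball (w p₀) (ε / (2 * k)) :=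
    (hwcont.tendsto p₀).eventually (Metric.ball_mem_nhds _ (by positivity))
  have hw₀ : w p₀ = v₀ - x₀ := hμ.eq_sum.symm
  refine ⟨_, hact.and (hcoeff.and (hR.eventually_linearIndepOn.and hwnear)),
    Metric.ball 0 (min ρ (ε / (2 * k))), Metric.ball_mem_nhds _ (by positivity), ?_⟩
  rintro p ⟨hactp, hcoeffp, hindp, hwp⟩ x x' ⟨hx, hx'⟩ hxV hxV'
  rw [mem_ball_zero_iff] at hxV hxV'
  have hsub := hactp x (mem_ball_iff_norm.2 (hxV.trans_le (min_le_left _ _)))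
  have hLIp : LinearIndepOn ℝ (fun i => R.g i p) ((R.I₁ ∪ K : Finset κ) : Set κ) :=
    linearIndepOn_of_abs_coeff_le (hcoeffp _ hμ.linearIndep)
  obtain ⟨L, hL, hLIL, c, hc, hsum⟩ :=
    R.exists_multipliers hx hx' Finset.subset_union_left hLIp
  have hLsub : (L : Set κ) ⊆ (R.active p x ∩ R.I₂) \ (K : Set κ) := fun i hi =>
    ⟨⟨(hL hi).1, fun h => (hL hi).2 (Finset.mem_union_left _ h)⟩,
      fun h => (hL hi).2 (Finset.mem_union_right _ h)⟩
  have hmono : (R.active p x ∩ R.I₂) \ (K : Set κ) ⊆ (R.active p₀ x₀ ∩ R.I₂) \ (K : Set κ) :=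
    sdiff_subset_sdiff_left (inter_subset_inter_left _ hsub)
  have hJ : ((R.I₁ ∪ K ∪ L : Finset κ) : Set κ) ⊆ R.active p₀ x₀ := by
    intro i hi
    simp only [Finset.coe_union, mem_union] at hi
    rcases hi with (h | h) | h
    · exact R.coe_I₁_subset_active hR.1 h
    · exact (hμ.subset h).1
    · exact hsub (hL h).1
  have hLI₀ := hindp _ (Finset.subset_union_left.trans Finset.subset_union_left) hJ hLIL
  have hdisj : ∀ i ∈ L, i ∉ R.I₁ ∪ K := fun i hi h => (hL hi).2 h
  -- Extending `μ` by `0` to `L` puts both combinations over one family, so that the coefficient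
  -- bound applies to `c - m`.
  set m : κ → ℝ := fun i => if i ∈ R.I₁ ∪ K then μ i else 0 with hm
  have hwm : w p = ∑ i ∈ R.I₁ ∪ K ∪ L, m i • R.g i p := by
    rw [← Finset.sum_subset (Finset.subset_union_left (s₁ := R.I₁ ∪ K) (s₂ := L))]
    · exact Finset.sum_congr rfl fun i hi => by simp only [hm, if_pos hi]
    · exact fun i _ hi => by simp only [hm, if_neg hi, zero_smul]
  have hclose : ∀ i ∈ R.I₁ ∪ K ∪ L, |c i - m i| ≤ ε := by
    intro i hi
    refine (hcoeffp _ hLI₀ (fun i => c i - m i) i hi).trans ?_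
    simp only [sub_smul, Finset.sum_sub_distrib]
    rw [← hsum, ← hwm]
    have h₁ := norm_sub_le_norm_sub_add_norm_sub x' (w p₀) (w p)
    rw [mem_ball_iff_norm, norm_sub_rev] at hwp
    have h₂ : ‖x' - w p₀‖ < ε / (2 * k) := by
      rw [hw₀]
      exact hxV'.trans_le (min_le_right _ _)
    calc k * ‖x' - w p‖ ≤ k * (ε / (2 * k) + ε / (2 * k)) :=
          mul_le_mul_of_nonneg_left (by linarith) hk.le
      _ = ε := by field_simp; ring
  refine ⟨L, hLsub, hmono, ⟨hLsub.trans hmono, hLI₀⟩, c, hsum, fun i hi => ?_, fun i hi => ?_⟩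
  · have := abs_le.1 (hclose i (Finset.mem_union_left _ hi))
    simp only [hm, if_pos hi] at this
    constructor <;> linarith
  · have := (abs_le.1 (hclose i (Finset.mem_union_right _ hi))).2
    simp only [hm, if_neg (hdisj i hi)] at this
    exact ⟨hc i hi, by linarith⟩

end ConstraintSystem

/-! ### From Lipschitz selections to the Aubin property, and the main theorem. -/

theorem lipschitzLikeAround_of_exists_norm_sub_le {G H : Type*} [NormedAddCommGroup G]
    [NormedAddCommGroup H] [NormedSpace ℝ H] {D : Set G} {F : D → Set H} {p₀ : D} {y₀ : H}
    {k ℓ : ℝ} (hk : 0 ≤ k) (hkℓ : k < ℓ) (hy₀ : y₀ ∈ F p₀) {U : Set D} (hU : U ∈ 𝓝 p₀)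
    {V : Set H} (hV : V ∈ 𝓝 (0 : H))
    (h : ∀ p₁ ∈ U, ∀ p₂ ∈ U, ∀ x₁ ∈ F p₁, x₁ - y₀ ∈ V →
      ∃ x₂ ∈ F p₂, ‖x₁ - x₂‖ ≤ k * ‖(p₁ : G) - (p₂ : G)‖) :
    LipschitzLikeAround F p₀ y₀ ℓ := by
  have hV' : {x | x - y₀ ∈ V} ∈ 𝓝 y₀ :=
    (continuous_id.sub continuous_const).continuousAt.preimage_mem_nhds (by simpa using hV)
  refine ⟨by linarith, hy₀, U, hU, _, hV', ?_⟩
  rintro p₁ hp₁ p₂ hp₂ x₁ ⟨hx₁, hx₁V⟩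
  -- For equal parameters the scaled open ball is `{0}`; otherwise the strict gap `k < ℓ` places `x₁
  -- - x₂` in the open ball.
  rcases eq_or_ne p₁ p₂ with rfl | hne
  · refine ⟨x₁, hx₁, 0, ⟨0, by simp, by simp⟩, add_zero _⟩
  obtain ⟨x₂, hx₂, hle⟩ := h p₁ hp₁ p₂ hp₂ x₁ hx₁ hx₁V
  have hδ : 0 < ‖(p₁ : G) - (p₂ : G)‖ := norm_pos_iff.2 (sub_ne_zero.2 fun h => hne (Subtype.ext h))
  have hs : 0 < ℓ * ‖(p₁ : G) - (p₂ : G)‖ := mul_pos (by linarith) hδ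
  refine ⟨x₂, hx₂, x₁ - x₂, ?_, add_sub_cancel _ _⟩
  rw [smul_unitBall hs.ne', mem_ball_zero_iff, Real.norm_of_nonneg hs.le]
  exact hle.trans_lt (mul_lt_mul_of_pos_right hkℓ hδ)

theorem corollary4p2
    {G : Type*} [NormedAddCommGroup G] [NormedSpace ℝ G]
    {H : Type*} [NormedAddCommGroup H] [InnerProductSpace ℝ H] [CompleteSpace H]
    {D : Set G}
    {ι : Type*} [Fintype ι] [Nonempty ι]
    {κ : Type*} [Fintype κ] [Nonempty κ] [DecidableEq κ]
    (C : ConstraintSystem D H ι)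
    (pbar : D) (vbar xbar : H)
    (hx : xbar ∈ C.sol pbar)
    (hactive : (C.active pbar xbar).Nonempty)
    (hnormal : vbar - xbar ∈ normalConeAt (C.sol pbar) xbar)
    (R : ConstraintSystem D H κ)
    (hRCRCQ : R.RCRCQ pbar xbar)
    (Kbar : Finset κ) (lambdaBar : κ → ℝ)
    (hstable : R.IsStableRepresentation C pbar vbar xbar Kbar lambdaBar) :
    ∃ ℓ : ℝ, 0 < ℓ ∧
      (∀ ε : ℝ, 0 < ε → ∃ U ∈ 𝓝 pbar, ∃ V ∈ 𝓝 (0 : H),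
        (∀ p ∈ U, ∀ x x' : H, (x, x') ∈ normalConeGraph (C.sol p) →
          x - xbar ∈ V → x' - (vbar - xbar) ∈ V →
          ∃ L : Finset κ,
            (L : Set κ) ⊆ (R.active p x ∩ R.I₂) \ (Kbar : Set κ) ∧
            (R.active p x ∩ R.I₂) \ (Kbar : Set κ) ⊆
              (R.active pbar xbar ∩ R.I₂) \ (Kbar : Set κ) ∧
            R.IsAdmissible pbar xbar Kbar L ∧
            ∃ lam : κ → ℝ,
              x' = ∑ i ∈ R.I₁ ∪ Kbar ∪ L, lam i • R.g i p ∧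
              (∀ i ∈ R.I₁ ∪ Kbar, lambdaBar i - ε ≤ lam i ∧ lam i ≤ lambdaBar i + ε) ∧
              (∀ i ∈ L, 0 < lam i ∧ lam i ≤ ε)) ∧
        (∀ L : Finset κ, R.IsAdmissible pbar xbar Kbar L →
          ∀ p₁ ∈ U, ∀ p₂ ∈ U, ∀ x₁ ∈ (R.tighten (Kbar ∪ L)).sol p₁, x₁ - xbar ∈ V →
            ∃ x₂ ∈ (R.tighten (Kbar ∪ L)).sol p₂,
              ‖x₁ - x₂‖ ≤ ℓ * ‖(p₁ : G) - (p₂ : G)‖)) ∧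
      (∀ L : Finset κ, R.IsAdmissible pbar xbar Kbar L →
        LipschitzLikeAround (R.tighten (Kbar ∪ L)).sol pbar xbar ℓ) := by
  have hK : (Kbar : Set κ) ⊆ R.active pbar xbar := fun i hi => (hstable.multipliers.subset hi).1
  obtain ⟨k, hk, U₀, hU₀, V₀, hV₀, hsel⟩ :=
    ConstraintSystem.exists_lipschitz_selection_tighten hRCRCQ hK hstable.liminf
  -- The modulus exceeds `k` because the Lipschitz-like property is stated with an open ball.
  refine ⟨k + 1, by linarith, fun ε hε => ?_, fun L hL => ?_⟩
  · obtain ⟨U, hU, V, hV, hmul⟩ :=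
      ConstraintSystem.exists_multipliers_near hRCRCQ hstable.multipliers hε
    refine ⟨U ∩ U₀, inter_mem hU hU₀, V ∩ V₀, inter_mem hV hV₀, ?_, ?_⟩
    · intro p hp x x' hxx' hxV hxV'
      rw [← hstable.equivalent p] at hxx'
      exact hmul p hp.1 x x' hxx' hxV.1 hxV'.1
    · intro L hL p₁ hp₁ p₂ hp₂ x₁ hx₁ hx₁V
      obtain ⟨x₂, hx₂, hle⟩ := hsel L hL p₁ hp₁.2 p₂ hp₂.2 x₁ hx₁ hx₁V.2
      exact ⟨x₂, hx₂, hle.trans (mul_le_mul_of_nonneg_right (by linarith) (norm_nonneg _))⟩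
  · exact lipschitzLikeAround_of_exists_norm_sub_le hk.le (lt_add_one k)
      (ConstraintSystem.mem_sol_tighten hRCRCQ.1 (hL.union_subset_active hK)) hU₀ hV₀ (hsel L hL)
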